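/- Graphs are finite, undirected, without loops or multiple edges. For a graph $G$, let $\rho(G)$ denote the largest eigenvalue of its adjacency matrix. For integers $1\le a\le b$, a graph $G$ has a fractional $[a,b]$-factor if there is a function $h:E(G)\to[0,1]$ with $a\le\sum_{e\ni v}h(e)\le b$ for every vertex $v$ (the sum being over the edges of $G$ incident with $v$), and $G$ is a fractional $[a,b]$-deleted graph if for every edge $e\in E(G)$ the graph $G-e$ has a fractional $[a,b]$-factor. Let $K_a\vee(K_{n-a-1}\cup K_1)$ denote the join of $K_a$ with the disjoint union of $K_{n-a-1}$ and $K_1$. **Theorem.** Let $a$ and $b$ be positive integers with $b\ge\max\{a,3\}$, and let $G$ be a graph of order $n\ge\max\{a+2,7\}$. If $$\rho(G)>\rho\bigl(K_a\vee(K_{n-a-1}\cup K_1)\bigr),$$ then $G$ is a fractional $[a,b]$-deleted graph. The condition is sharp in that $>$ cannot be replaced by $\ge$: for all positive integers $a\le b$ and $n\ge a+2$, the graph $K_a\vee(K_{n-a-1}\cup K_1)$, which has order $n$, is not a fractional $[a,b]$-deleted graph. -/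

import Mathlib

open scoped BigOperators

namespace FractionalDeleted

/-- The join `G ∨ H`: the disjoint union of `G` and `H` together with all the edges between
a vertex of `G` and a vertex of `H`. -/
def join {V W : Type*} (G : SimpleGraph V) (H : SimpleGraph W) : SimpleGraph (V ⊕ W) :=
  (G ⊕g H) ⊔ completeBipartiteGraph V W

/-- The graph `K_a ∨ (K_{n-a-1} ∪ K_1)`; it has `n` vertices when `a + 1 ≤ n`. -/
def extremalGraph (a n : ℕ) : SimpleGraph (Fin a ⊕ (Fin (n - a - 1) ⊕ Fin 1)) :=
  join (⊤ : SimpleGraph (Fin a)) ((⊤ : SimpleGraph (Fin (n - a - 1))) ⊕g (⊤ : SimpleGraph (Fin 1)))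

open Classical in
/-- The spectral radius `ρ(G)`: the largest eigenvalue of the adjacency matrix of `G`.
The supremum is attained when `G` has a vertex, see `isGreatest_spectralRadius`. -/
noncomputable def spectralRadius {V : Type*} [Fintype V] (G : SimpleGraph V) : ℝ :=
  sSup (spectrum ℝ (G.adjMatrix ℝ))

open Classical in
theorem isGreatest_spectralRadius {V : Type*} [Fintype V] [Nonempty V] (G : SimpleGraph V) :
    IsGreatest (spectrum ℝ (G.adjMatrix ℝ)) (spectralRadius G) := by
  have hA : (G.adjMatrix ℝ).IsHermitian := by
    rw [Matrix.IsHermitian, Matrix.conjTranspose_eq_transpose_of_trivial]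
    exact G.isSymm_adjMatrix
  have hs : spectrum ℝ (G.adjMatrix ℝ) = Set.range hA.eigenvalues :=
    hA.spectrum_real_eq_range_eigenvalues
  have hf : (spectrum ℝ (G.adjMatrix ℝ)).Finite := hs ▸ Set.finite_range _
  have hn : (spectrum ℝ (G.adjMatrix ℝ)).Nonempty := hs ▸ Set.range_nonempty _
  exact ⟨hn.csSup_mem hf, fun x hx => le_csSup hf.bddAbove hx⟩

open Classical in
/-- `G` contains a fractional `[a,b]`-factor: there is `h : E(G) → [0,1]` such that for every
vertex `v` the sum of `h` over the edges of `G` incident with `v` lies in `[a,b]`. (The factor is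
the spanning subgraph with edge set `{e ∈ E(G) | h e > 0}`, which is determined by `h`; only the
values of `h` on edges of `G` matter.) -/
def HasFractionalFactor {V : Type*} [Fintype V] (G : SimpleGraph V) (a b : ℕ) : Prop :=
  ∃ h : Sym2 V → ℝ, (∀ e ∈ G.edgeSet, 0 ≤ h e ∧ h e ≤ 1) ∧
    ∀ v : V, (a : ℝ) ≤ ∑ e ∈ G.incidenceFinset v, h e ∧ ∑ e ∈ G.incidenceFinset v, h e ≤ (b : ℝ)

/-- `G` is a fractional `[a,b]`-deleted graph: `G - e` contains a fractional `[a,b]`-factor for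
every edge `e` of `G`. -/
def IsFractionalDeleted {V : Type*} [Fintype V] (G : SimpleGraph V) (a b : ℕ) : Prop :=
  ∀ e ∈ G.edgeSet, HasFractionalFactor (G.deleteEdges {e}) a b

end FractionalDeleted

namespace FractionalDeleted

/-! If `G - e` has no fractional factor, a barrier `(S, T)` exists (Anstee), and counting
non-neighbours of the vertices of `T` shows that the complement of `G - e` has at least `n - a`
edges. Hence `G` misses at least `k = n - a - 1` edges, which is the number missed by the extremal
graph, the complement of a star with `k` edges plus isolated vertices. It remains to see that this
graph maximizes the spectral radius (`spectralRadius_le_extremalGraph`).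

For this, let `H` have `k` edges and take a nonnegative eigenvector of `Hᶜ`. Bounding a
degree-weighted sum edge by edge gives a cubic inequality in `μ = ρ(Hᶜ) + 1`
(`cubic_of_card_edgeFinset`); every estimate is tight for a star. Conversely, for `μ > a + k` that
inequality is exactly what makes an explicit three-valued vector a subsolution on the extremal graph
(`le_spectralRadius_extremalGraph`), so `μ - 1` cannot exceed its spectral radius. -/

/-! ### Anstee's criterion by convex duality -/

open Classical in
/-- The piecewise linear function that decides a fractional factor, evaluated at vertex weights `y`: half the sum
of `(y u + y v)⁺` over ordered adjacent pairs, minus `∑ (a y⁺ - b y⁻)`. -/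
noncomputable def defect {V : Type*} [Fintype V] (G : SimpleGraph V) (a b : ℝ) (y : V → ℝ) : ℝ :=
  (∑ v, ∑ u, if G.Adj v u then max (y v + y u) 0 else 0) / 2
    - ∑ v, (a * max (y v) 0 - b * max (-y v) 0)

/-- Subtracting `m` times the signs splits the positive part of a sum additively, if `m` is at most
all the nonzero absolute values. -/
theorem max_add_sign_split {m p q : ℝ} (hm : 0 < m) (hp : p = 0 ∨ m ≤ |p|)
    (hq : q = 0 ∨ m ≤ |q|) :
    max (p + q) 0 = max ((p - m * Real.sign p) + (q - m * Real.sign q)) 0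
      + m * max (Real.sign p + Real.sign q) 0 := by
  have key : ∀ r : ℝ, (r = 0 ∨ m ≤ |r|) →
      (r = 0 ∧ Real.sign r = 0) ∨ (m ≤ r ∧ Real.sign r = 1) ∨ (r ≤ -m ∧ Real.sign r = -1) := by
    rintro r (h | h)
    · exact Or.inl ⟨h, by simp [h]⟩
    · rcases le_abs.1 h with h | h
      · exact Or.inr (Or.inl ⟨h, Real.sign_of_pos (by linarith)⟩)
      · exact Or.inr (Or.inr ⟨by linarith, Real.sign_of_neg (by linarith)⟩)
  rcases key p hp with ⟨h1, h2⟩ | ⟨h1, h2⟩ | ⟨h1, h2⟩ <;>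
  rcases key q hq with ⟨h3, h4⟩ | ⟨h3, h4⟩ | ⟨h3, h4⟩ <;>
  rw [h2, h4] <;> norm_num <;>
  grind

/-- The defect is linear on each cone where the signs of all `y v` and `y v + y u` are weakly fixed;
`sign y` and the remainder lie in a common such cone. -/
theorem defect_sign_split {V : Type*} [Fintype V] (G : SimpleGraph V) (a b : ℝ) (y : V → ℝ)
    {m : ℝ} (hm : 0 < m) (hy : ∀ v, y v = 0 ∨ m ≤ |y v|) :
    defect G a b y = defect G a b (fun v => y v - m * Real.sign (y v))
      + m * defect G a b (fun v => Real.sign (y v)) := by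
  classical
  have h1 : ∀ v, max (y v) 0 = max (y v - m * Real.sign (y v)) 0
      + m * max (Real.sign (y v)) 0 := fun v => by
    simpa using max_add_sign_split hm (hy v) (Or.inl rfl : (0 : ℝ) = 0 ∨ _)
  have h2 : ∀ v, max (-y v) 0 = max (-(y v - m * Real.sign (y v))) 0
      + m * max (-Real.sign (y v)) 0 := fun v => by
    have h : -y v = 0 ∨ m ≤ |-y v| := by simpa using hy v
    have := max_add_sign_split hm h (Or.inl rfl : (0 : ℝ) = 0 ∨ _)
    rw [Real.sign_neg] at this
    simp only [Real.sign_zero, mul_zero, add_zero, sub_zero] at this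
    rw [this]
    congr 2
    ring
  have h3 : ∀ v u, (if G.Adj v u then max (y v + y u) 0 else 0)
      = (if G.Adj v u then max ((y v - m * Real.sign (y v)) + (y u - m * Real.sign (y u))) 0 else 0)
        + m * (if G.Adj v u then max (Real.sign (y v) + Real.sign (y u)) 0 else 0) := by
    intro v u
    split_ifs
    · exact max_add_sign_split hm (hy v) (hy u)
    · simp
  have h4 : ∀ v, (a * max (y v) 0 - b * max (-y v) 0)
      = (a * max (y v - m * Real.sign (y v)) 0 - b * max (-(y v - m * Real.sign (y v))) 0)
        + m * (a * max (Real.sign (y v)) 0 - b * max (-Real.sign (y v)) 0) := fun v => by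
    rw [h1, h2]; ring
  unfold defect
  simp only [h3, h4, Finset.sum_add_distrib, ← Finset.mul_sum]
  ring

/-- A negative defect is witnessed by a weight with values in `{-1, 0, 1}`. -/
theorem exists_sign_defect_neg {V : Type*} [Fintype V] (G : SimpleGraph V) (a b : ℝ) (y : V → ℝ)
    (hy : defect G a b y < 0) : ∃ z : V → ℝ, defect G a b (fun v => Real.sign (z v)) < 0 := by
  classical
  induction hN : (Finset.univ.filter fun v => y v ≠ 0).card using Nat.strong_induction_on
    generalizing y with
  | _ N ih =>
    rcases (Finset.univ.filter fun v => y v ≠ 0).eq_empty_or_nonempty with he | hne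
    · have : y = 0 := by
        funext v
        by_contra h
        have : v ∈ (Finset.univ.filter fun v => y v ≠ 0) := by simpa using h
        simp [he] at this
      subst this
      simp [defect] at hy
    · obtain ⟨w, hw, hmin⟩ := Finset.exists_min_image _ (fun v => |y v|) hne
      have hw0 : y w ≠ 0 := by simpa using hw
      have hm : 0 < |y w| := abs_pos.2 hw0
      have hall : ∀ v, y v = 0 ∨ |y w| ≤ |y v| := fun v =>
        (em (y v = 0)).imp_right fun h => hmin v (by simpa using h)
      have hs := defect_sign_split G a b y hm hall
      by_cases hneg : defect G a b (fun v => Real.sign (y v)) < 0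
      · exact ⟨y, hneg⟩
      -- The remainder has negative defect and vanishes at `w`, where `|y|` is least, so its support
      -- is smaller.
      · refine ih _ ?_ (fun v => y v - |y w| * Real.sign (y v)) ?_ rfl
        · rw [← hN]
          apply Finset.card_lt_card
          refine ⟨fun v => ?_, fun h => ?_⟩
          · simp only [Finset.mem_filter, Finset.mem_univ, true_and]
            intro h h0
            simp [h0] at h
          · have := h hw
            simp only [Finset.mem_filter, Finset.mem_univ, true_and] at this
            apply this
            rcases lt_or_gt_of_ne hw0 with h | h
            · rw [Real.sign_of_neg h, abs_of_neg h]; ring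
            · rw [Real.sign_of_pos h, abs_of_pos h]; ring
        · have := mul_nonneg hm.le (not_lt.1 hneg)
          linarith

open Classical in
theorem sum_incidenceFinset {V : Type*} [Fintype V] (G : SimpleGraph V) (h : Sym2 V → ℝ) (v : V) :
    ∑ e ∈ G.incidenceFinset v, h e = ∑ u, if G.Adj v u then h s(v, u) else 0 := by
  rw [← Finset.sum_filter]
  symm
  refine Finset.sum_bij (fun u _ => s(v, u)) ?_ ?_ ?_ ?_
  · intro u hu
    simpa [SimpleGraph.mem_incidenceFinset, SimpleGraph.mem_incidenceSet] using hu
  · intro u _ u' _ h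
    exact Sym2.congr_right.1 h
  · intro e he
    rw [SimpleGraph.mem_incidenceFinset] at he
    obtain ⟨he, u, rfl⟩ := he
    exact ⟨u, by simpa using he, rfl⟩
  · simp

open Classical in
/-- Without a fractional `[a,b]`-factor, some vertex weight has negative defect. -/
theorem exists_defect_neg {V : Type*} [Fintype V] (G : SimpleGraph V) (a b : ℕ) (hab : a ≤ b)
    (hG : ¬ HasFractionalFactor G a b) : ∃ y : V → ℝ, defect G a b y < 0 := by
  -- Weights live on ordered pairs and are symmetrized here, so the admissible ones form a plain
  -- cube.
  let L : (V → V → ℝ) →ₗ[ℝ] (V → ℝ) :=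
    { toFun := fun w v => ∑ u, if G.Adj v u then (w v u + w u v) / 2 else 0
      map_add' := by
        intro w w'
        funext v
        simp only [Pi.add_apply, ← Finset.sum_add_distrib]
        refine Finset.sum_congr rfl fun u _ => ?_
        split_ifs <;> ring
      map_smul' := by
        intro c w
        funext v
        simp only [Pi.smul_apply, smul_eq_mul, RingHom.id_apply, Finset.mul_sum]
        refine Finset.sum_congr rfl fun u _ => ?_
        split_ifs <;> ring }
  have hL : ∀ w v, L w v = ∑ u, if G.Adj v u then (w v u + w u v) / 2 else 0 := fun _ _ => rfl
  let K : Set (V → V → ℝ) := Set.pi Set.univ fun _ => Set.pi Set.univ fun _ => Set.Icc 0 1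
  have hKc : IsCompact K := isCompact_univ_pi fun _ => isCompact_univ_pi fun _ => isCompact_Icc
  have hKx : Convex ℝ K := convex_pi fun _ _ => convex_pi fun _ _ => convex_Icc 0 1
  let B : Set (V → ℝ) := Set.pi Set.univ fun _ => Set.Icc (a : ℝ) b
  have hBc : IsClosed B := isClosed_set_pi fun _ _ => isClosed_Icc
  have hBx : Convex ℝ B := convex_pi fun _ _ => convex_Icc _ _
  have hdis : Disjoint (L '' K) B := by
    rw [Set.disjoint_left]
    rintro _ ⟨w, hw, rfl⟩ hB
    apply hG
    have hw' : ∀ v u, 0 ≤ w v u ∧ w v u ≤ 1 := fun v u => hw v trivial u trivial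
    refine ⟨Sym2.lift ⟨fun v u => (w v u + w u v) / 2, fun v u => by ring⟩, ?_, ?_⟩
    · intro e _
      induction e with
      | _ v u =>
        have h1 := hw' v u
        have h2 := hw' u v
        simp only [Sym2.lift_mk]
        constructor <;> linarith
    · intro v
      rw [sum_incidenceFinset]
      simpa [hL] using hB v trivial
  obtain ⟨f, s, t, h1, hst, h2⟩ := geometric_hahn_banach_compact_closed
    (hKx.linear_image L) (hKc.image L.continuous_of_finiteDimensional) hBx hBc hdis
  let y : V → ℝ := fun v => f (Pi.single v 1)
  have hf : ∀ z : V → ℝ, f z = ∑ v, z v * y v := by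
    intro z
    conv_lhs => rw [← Finset.univ_sum_single z]
    rw [map_sum]
    refine Finset.sum_congr rfl fun v _ => ?_
    rw [← smul_eq_mul, ← map_smul, ← Pi.single_smul, smul_eq_mul, mul_one]
  refine ⟨y, ?_⟩
  -- The separating functional is tested at its maximizer on the cube and, next, at its minimizer on
  -- the box `[a,b]^V`; the two values differ by the defect.
  have hk := h1 (L fun v u => if 0 ≤ y v + y u then 1 else 0) ⟨_, by
    intro v _ u _
    dsimp only
    split_ifs <;> simp, rfl⟩
  have hb := h2 (fun v => if 0 ≤ y v then (a : ℝ) else b) (by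
    have : (a : ℝ) ≤ b := by exact_mod_cast hab
    intro v _
    dsimp only
    split_ifs <;> simp [this])
  have e1 : f (L fun v u => if 0 ≤ y v + y u then 1 else 0)
      = (∑ v, ∑ u, if G.Adj v u then max (y v + y u) 0 else 0) / 2 := by
    have hswap : ∀ v u, (if 0 ≤ y u + y v then (1 : ℝ) else 0) = if 0 ≤ y v + y u then 1 else 0 :=
      fun v u => by rw [add_comm]
    have e : f (L fun v u => if 0 ≤ y v + y u then 1 else 0)
        = ∑ v, ∑ u, if G.Adj v u then (if 0 ≤ y v + y u then (1 : ℝ) else 0) * y v else 0 := by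
      rw [hf]
      refine Finset.sum_congr rfl fun v _ => ?_
      rw [hL, Finset.sum_mul]
      refine Finset.sum_congr rfl fun u _ => ?_
      rw [hswap]
      split_ifs <;> ring
    have e' : f (L fun v u => if 0 ≤ y v + y u then 1 else 0)
        = ∑ v, ∑ u, if G.Adj v u then (if 0 ≤ y v + y u then (1 : ℝ) else 0) * y u else 0 := by
      rw [e, Finset.sum_comm]
      refine Finset.sum_congr rfl fun v _ => Finset.sum_congr rfl fun u _ => ?_
      rw [G.adj_comm, hswap]
    rw [eq_div_iff two_ne_zero, mul_two]
    nth_rewrite 1 [e]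
    rw [e', ← Finset.sum_add_distrib]
    refine Finset.sum_congr rfl fun v _ => ?_
    rw [← Finset.sum_add_distrib]
    refine Finset.sum_congr rfl fun u _ => ?_
    split_ifs with h3 h4
    · rw [max_eq_left h4]; ring
    · rw [max_eq_right (by linarith)]; ring
    · ring
  have e2 : f (fun v => if 0 ≤ y v then (a : ℝ) else b)
      = ∑ v, (a * max (y v) 0 - b * max (-y v) 0) := by
    rw [hf]
    refine Finset.sum_congr rfl fun v _ => ?_
    split_ifs with h3
    · rw [max_eq_left h3, max_eq_right (by linarith)]; ring
    · rw [max_eq_right (by linarith), max_eq_left (by linarith)]; ring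
  unfold defect
  linarith

open Classical in
/-- The nontrivial half of Anstee's criterion for fractional `[a,b]`-factors. -/
theorem exists_barrier {V : Type*} [Fintype V] (G : SimpleGraph V) (a b : ℕ) (hab : a ≤ b)
    (hG : ¬ HasFractionalFactor G a b) : ∃ S T : Finset V, Disjoint S T ∧
      b * S.card + ∑ v ∈ T, (Finset.univ.filter fun u => G.Adj v u ∧ u ∉ S).card < a * T.card := by
  obtain ⟨y, hy⟩ := exists_defect_neg G a b hab hG
  obtain ⟨z, hz⟩ := exists_sign_defect_neg G a b y hy
  refine ⟨Finset.univ.filter fun v => z v < 0, Finset.univ.filter fun v => 0 < z v, ?_, ?_⟩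
  · rw [Finset.disjoint_left]
    intro v h1 h2
    simp only [Finset.mem_filter, Finset.mem_univ, true_and] at h1 h2
    linarith
  have hs : ∀ v, (z v < 0 ∧ Real.sign (z v) = -1) ∨ (z v = 0 ∧ Real.sign (z v) = 0) ∨
      (0 < z v ∧ Real.sign (z v) = 1) := by
    intro v
    rcases lt_trichotomy (z v) 0 with h | h | h
    · exact Or.inl ⟨h, Real.sign_of_neg h⟩
    · exact Or.inr (Or.inl ⟨h, by simp [h]⟩)
    · exact Or.inr (Or.inr ⟨h, Real.sign_of_pos h⟩)
  have e1 : ∑ v, ((a : ℝ) * max (Real.sign (z v)) 0 - b * max (-Real.sign (z v)) 0)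
      = a * (Finset.univ.filter fun v => 0 < z v).card
        - b * (Finset.univ.filter fun v => z v < 0).card := by
    simp only [Finset.card_filter, Nat.cast_sum, Finset.mul_sum, ← Finset.sum_sub_distrib]
    refine Finset.sum_congr rfl fun v _ => ?_
    rcases hs v with ⟨h, h'⟩ | ⟨h, h'⟩ | ⟨h, h'⟩ <;> rw [h'] <;>
      simp [h, not_lt.2 h.le]
  -- An edge inside `T` contributes 2, an edge from `T` to a vertex of sign 0 contributes 1, and all
  -- others contribute 0.
  have e2 : (∑ v, ∑ u, if G.Adj v u then max (Real.sign (z v) + Real.sign (z u)) 0 else 0) / 2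
      = ∑ v, ∑ u, if 0 < z v ∧ G.Adj v u ∧ ¬ z u < 0 then (1 : ℝ) else 0 := by
    rw [div_eq_iff two_ne_zero, mul_two]
    nth_rewrite 3 [Finset.sum_comm]
    rw [← Finset.sum_add_distrib]
    refine Finset.sum_congr rfl fun v _ => ?_
    rw [← Finset.sum_add_distrib]
    refine Finset.sum_congr rfl fun u _ => ?_
    rw [G.adj_comm u v]
    by_cases ha : G.Adj v u
    · rcases hs v with ⟨h, h'⟩ | ⟨h, h'⟩ | ⟨h, h'⟩ <;>
      rcases hs u with ⟨g, g'⟩ | ⟨g, g'⟩ | ⟨g, g'⟩ <;> rw [h', g'] <;>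
      simp [ha, h, g, not_lt.2 h.le, not_lt.2 g.le]
    · simp [ha]
  have e3 : ((∑ v ∈ Finset.univ.filter fun v => 0 < z v, (Finset.univ.filter fun u =>
      G.Adj v u ∧ u ∉ Finset.univ.filter fun v => z v < 0).card : ℕ) : ℝ)
      = ∑ v, ∑ u, if 0 < z v ∧ G.Adj v u ∧ ¬ z u < 0 then (1 : ℝ) else 0 := by
    rw [Finset.sum_filter, Nat.cast_sum]
    refine Finset.sum_congr rfl fun v _ => ?_
    by_cases h : 0 < z v <;> simp [h]
  unfold defect at hz
  rw [e1, e2, ← e3] at hz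
  have hz' : (b : ℝ) * (Finset.univ.filter fun v => z v < 0).card
      + ((∑ v ∈ Finset.univ.filter fun v => 0 < z v, (Finset.univ.filter fun u =>
      G.Adj v u ∧ u ∉ Finset.univ.filter fun v => z v < 0).card : ℕ) : ℝ)
      < a * (Finset.univ.filter fun v => 0 < z v).card := by linarith
  exact_mod_cast hz'

/-! ### Counting missing edges -/

open Classical in
theorem degree_add_degree_le {V : Type*} [Fintype V] (H : SimpleGraph V) {u v : V} (h : u ≠ v) :
    H.degree u + H.degree v ≤ H.edgeFinset.card + 1 := by
  rw [← H.card_incidenceFinset_eq_degree u, ← H.card_incidenceFinset_eq_degree v,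
    ← Finset.card_union_add_card_inter]
  gcongr
  · exact Finset.union_subset (H.incidenceFinset_subset u) (H.incidenceFinset_subset v)
  · rw [Finset.card_le_one]
    have key : ∀ e ∈ H.incidenceFinset u ∩ H.incidenceFinset v, e = s(u, v) := by
      intro e he
      simp only [Finset.mem_inter, SimpleGraph.mem_incidenceFinset] at he
      exact (Sym2.mem_and_mem_iff h).1 ⟨he.1.2, he.2.2⟩
    intro e he e' he'
    rw [key e he, key e' he']

open Classical in
/-- A graph of order `n` without a fractional `[a,b]`-factor misses at least `n - a` edges. -/
theorem card_edgeFinset_compl_of_no_factor {V : Type*} [Fintype V] (G : SimpleGraph V)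
    {a b n : ℕ} (hab : a ≤ b) (hb : 2 ≤ b) (hn : Fintype.card V = n) (han : a + 2 ≤ n)
    (hG : ¬ HasFractionalFactor G a b) : n ≤ Gᶜ.edgeFinset.card + a := by
  obtain ⟨S, T, hST, h⟩ := exists_barrier G a b hab hG
  by_contra! hlt
  have hd : ∀ v ∈ T, n ≤ (Finset.univ.filter fun u => G.Adj v u ∧ u ∉ S).card + S.card
      + (Gᶜ.degree v + 1) := by
    intro v hv
    rw [← hn, ← Finset.card_univ, ← Gᶜ.card_neighborFinset_eq_degree v]
    have : (Finset.univ : Finset V) ⊆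
        ((Finset.univ.filter fun u => G.Adj v u ∧ u ∉ S) ∪ S) ∪ insert v (Gᶜ.neighborFinset v) := by
      intro u _
      simp only [Finset.mem_union, Finset.mem_filter, Finset.mem_univ, true_and,
        Finset.mem_insert, SimpleGraph.mem_neighborFinset, SimpleGraph.compl_adj]
      by_cases h1 : u ∈ S <;> by_cases h2 : G.Adj v u <;> by_cases h3 : u = v <;>
        simp [h1, h2, h3, Ne.symm]
    exact (Finset.card_le_card this).trans ((Finset.card_union_le _ _).trans
      (add_le_add (Finset.card_union_le _ _) (Finset.card_insert_le _ _)))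
  have hsum : T.card * n ≤ ∑ v ∈ T, (Finset.univ.filter fun u => G.Adj v u ∧ u ∉ S).card
      + T.card * S.card + ∑ v ∈ T, Gᶜ.degree v + T.card := by
    have := Finset.sum_le_sum hd
    simp only [Finset.sum_add_distrib, Finset.sum_const, smul_eq_mul, mul_one] at this
    omega
  have h2 : ∑ v ∈ T, Gᶜ.degree v ≤ 2 * Gᶜ.edgeFinset.card := by
    rw [← Gᶜ.sum_degrees_eq_twice_card_edges]
    exact Finset.sum_le_sum_of_subset (Finset.subset_univ _)
  have hcard : S.card + T.card ≤ n := by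
    rw [← Finset.card_union_of_disjoint hST, ← hn]
    exact Finset.card_le_univ _
  obtain ⟨k, rfl⟩ : ∃ k, n = a + 1 + k := ⟨n - (a + 1), by omega⟩
  have hm : Gᶜ.edgeFinset.card ≤ k := by omega
  have hmain : b * S.card + 1 + T.card * k ≤ T.card * S.card + ∑ v ∈ T, Gᶜ.degree v := by
    nlinarith
  -- For `|T| ≤ 2` the handshake bound `2 * k` on the degree sum is too weak; it is replaced by `k`
  -- or `k + 1`.
  rcases Nat.lt_or_ge T.card 3 with ht | ht
  · interval_cases hT : T.card
    · simp only [Finset.card_eq_zero] at hT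
      simp [hT] at h
    · obtain ⟨v, rfl⟩ := Finset.card_eq_one.1 hT
      have := (Finset.card_le_card (Gᶜ.incidenceFinset_subset v))
      rw [Gᶜ.card_incidenceFinset_eq_degree] at this
      rw [Finset.sum_singleton] at hmain
      nlinarith
    · obtain ⟨u, v, huv, rfl⟩ := Finset.card_eq_two.1 hT
      have := degree_add_degree_le Gᶜ huv
      rw [Finset.sum_pair huv] at hmain
      have : 2 * S.card ≤ b * S.card := Nat.mul_le_mul_right _ hb
      omega
  · have h3 : b * S.card + 1 + T.card * k ≤ T.card * S.card + 2 * k := by omega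
    zify at h3 hab hb ht hcard
    rcases le_total (T.card : ℤ) b with htb | htb
    · nlinarith [mul_nonneg (sub_nonneg.2 htb) (Nat.cast_nonneg (α := ℤ) S.card),
        mul_nonneg (sub_nonneg.2 ht) (Nat.cast_nonneg (α := ℤ) k)]
    · rcases eq_or_lt_of_le htb with he | hlt'
      · rw [he] at h3
        nlinarith [mul_nonneg (sub_nonneg.2 ht) (Nat.cast_nonneg (α := ℤ) k)]
      -- Here `|T| ≥ b + 1 ≥ a + 1`, and `S` is disjoint from `T` among `a + 1 + k` vertices.
      · have hsk : (S.card : ℤ) ≤ k := by linarith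
        nlinarith [mul_nonneg (sub_nonneg.2 htb) (sub_nonneg.2 hsk),
          mul_nonneg (sub_nonneg.2 hb) (Nat.cast_nonneg (α := ℤ) k)]

/-! ### Variational properties of the spectral radius -/

open Classical in
theorem adjMatrix_mulVec_eq {V : Type*} [Fintype V] (G : SimpleGraph V) (x : V → ℝ) (v : V) :
    (G.adjMatrix ℝ).mulVec x v = ∑ u, if G.Adj v u then x u else 0 := by
  simp [Matrix.mulVec, dotProduct, SimpleGraph.adjMatrix_apply]

open Classical in
theorem posSemidef_spectralRadius_sub {V : Type*} [Fintype V] [Nonempty V] (G : SimpleGraph V) :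
    (algebraMap ℝ (Matrix V V ℝ) (spectralRadius G) - G.adjMatrix ℝ).PosSemidef := by
  have hA : (G.adjMatrix ℝ).IsHermitian := by
    rw [Matrix.IsHermitian, Matrix.conjTranspose_eq_transpose_of_trivial]
    exact G.isSymm_adjMatrix
  rw [Matrix.posSemidef_iff_isHermitian_and_spectrum_nonneg]
  refine ⟨?_, ?_⟩
  · refine Matrix.IsHermitian.sub ?_ hA
    rw [Matrix.algebraMap_eq_diagonal]
    exact Matrix.isHermitian_diagonal _
  · rw [← spectrum.singleton_sub_eq]
    rintro _ ⟨r, rfl, t, ht, rfl⟩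
    simpa using (isGreatest_spectralRadius G).2 ht

open Classical in
theorem dotProduct_spectralRadius_sub {V : Type*} [Fintype V] (G : SimpleGraph V) (r : ℝ)
    (x : V → ℝ) : x ⬝ᵥ (algebraMap ℝ (Matrix V V ℝ) r - G.adjMatrix ℝ).mulVec x
      = r * ∑ v, x v * x v - ∑ v, ∑ u, if G.Adj v u then x v * x u else 0 := by
  rw [Matrix.sub_mulVec, dotProduct_sub, Algebra.algebraMap_eq_smul_one, Matrix.smul_mulVec,
    Matrix.one_mulVec, dotProduct_smul, smul_eq_mul]
  congr 1
  simp only [dotProduct, adjMatrix_mulVec_eq, Finset.mul_sum, mul_ite, mul_zero]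

open Classical in
theorem rayleigh_le {V : Type*} [Fintype V] (G : SimpleGraph V) (x : V → ℝ) :
    ∑ v, ∑ u, (if G.Adj v u then x v * x u else 0) ≤ spectralRadius G * ∑ v, x v * x v := by
  rcases isEmpty_or_nonempty V with hV | hV
  · simp
  have := (posSemidef_spectralRadius_sub G).dotProduct_mulVec_nonneg x
  rw [star_trivial, dotProduct_spectralRadius_sub] at this
  linarith

theorem sum_mul_self_pos {V : Type*} [Fintype V] {x : V → ℝ} {v : V} (hv : x v ≠ 0) :
    0 < ∑ v, x v * x v :=
  Finset.sum_pos' (fun _ _ => mul_self_nonneg _) ⟨v, Finset.mem_univ _, mul_self_pos.2 hv⟩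

open Classical in
/-- A nonnegative nonzero subsolution bounds the spectral radius from below. -/
theorem le_spectralRadius_of_le {V : Type*} [Fintype V] (G : SimpleGraph V) (x : V → ℝ) {r : ℝ}
    (hx : ∀ v, 0 ≤ x v) {v₀ : V} (h0 : x v₀ ≠ 0)
    (h : ∀ v, r * x v ≤ ∑ u, if G.Adj v u then x u else 0) : r ≤ spectralRadius G := by
  have h1 := rayleigh_le G x
  have h2 : r * ∑ v, x v * x v ≤ ∑ v, ∑ u, (if G.Adj v u then x v * x u else 0) := by
    rw [Finset.mul_sum]
    refine Finset.sum_le_sum fun v _ => ?_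
    have := mul_le_mul_of_nonneg_left (h v) (hx v)
    simp only [Finset.mul_sum, mul_ite, mul_zero] at this
    linarith
  exact le_of_mul_le_mul_right (h2.trans h1) (sum_mul_self_pos h0)

open Classical in
/-- The spectral radius has a nonnegative eigenvector. -/
theorem exists_nonneg_eigenvector {V : Type*} [Fintype V] [Nonempty V] (G : SimpleGraph V) :
    ∃ x : V → ℝ, (∀ v, 0 ≤ x v) ∧ (∃ v, x v ≠ 0) ∧
      ∀ v, ∑ u, (if G.Adj v u then x u else 0) = spectralRadius G * x v := by
  have hmem := (isGreatest_spectralRadius G).1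
  rw [← Matrix.spectrum_toLin', ← Module.End.hasEigenvalue_iff_mem_spectrum] at hmem
  obtain ⟨y, hy⟩ := hmem.exists_hasEigenvector
  have hy0 : ∃ v, y v ≠ 0 := by
    by_contra! h
    exact hy.2 (funext h)
  have hyv : ∀ v, ∑ u, (if G.Adj v u then y u else 0) = spectralRadius G * y v := by
    intro v
    have := congrFun hy.apply_eq_smul v
    rwa [Matrix.toLin'_apply, adjMatrix_mulVec_eq] at this
  refine ⟨fun v => |y v|, fun v => abs_nonneg _, by simpa using hy0, ?_⟩
  -- Taking absolute values does not lower the Rayleigh quotient, so `|y|` is a zero of a positive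
  -- semidefinite form and hence lies in its kernel.
  have hq : (fun v => |y v|) ⬝ᵥ (algebraMap ℝ (Matrix V V ℝ) (spectralRadius G)
      - G.adjMatrix ℝ).mulVec (fun v => |y v|) = 0 := by
    apply le_antisymm
    · rw [dotProduct_spectralRadius_sub, sub_nonpos, Finset.mul_sum]
      refine Finset.sum_le_sum fun v _ => ?_
      rw [abs_mul_abs_self]
      have := congrArg (y v * ·) (hyv v)
      simp only [Finset.mul_sum, mul_ite, mul_zero] at this
      calc spectralRadius G * (y v * y v) = y v * (spectralRadius G * y v) := by ring
        _ = _ := this.symm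
        _ ≤ _ := by
          refine Finset.sum_le_sum fun u _ => ?_
          split_ifs
          · exact (le_abs_self _).trans (abs_mul _ _).le
          · exact le_rfl
    · simpa using (posSemidef_spectralRadius_sub G).dotProduct_mulVec_nonneg (fun v => |y v|)
  have h0 := ((posSemidef_spectralRadius_sub G).dotProduct_mulVec_zero_iff (fun v => |y v|)).1
    (by simpa using hq)
  intro v
  have := congrFun h0 v
  rw [Matrix.sub_mulVec, Algebra.algebraMap_eq_smul_one, Matrix.smul_mulVec, Matrix.one_mulVec,
    Pi.sub_apply, adjMatrix_mulVec_eq, Pi.smul_apply, smul_eq_mul, Pi.zero_apply] at this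
  linarith

/-- A nonnegative eigenvector of the smaller graph is a subsolution for the larger one. -/
theorem spectralRadius_mono {V : Type*} [Fintype V] {G G' : SimpleGraph V} (h : G ≤ G') :
    spectralRadius G ≤ spectralRadius G' := by
  classical
  rcases isEmpty_or_nonempty V with hV | hV
  · rw [Subsingleton.elim G G']
  obtain ⟨x, hx, ⟨v, hv⟩, he⟩ := exists_nonneg_eigenvector G
  refine le_spectralRadius_of_le G' x hx hv fun v => ?_
  rw [← he v]
  refine Finset.sum_le_sum fun u _ => ?_
  split_ifs with h1 h2 h2
  · exact le_rfl
  · exact absurd (h h1) h2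
  · exact hx u
  · exact le_rfl

/-! ### The cubic inequality and the extremal graph -/

open Classical in
/-- If `H` has `k` edges and `μ = ρ(Hᶜ) + 1`, then `μ` lies weakly below the largest root of the
cubic that belongs to a complementary star with `k` edges. -/
theorem cubic_of_card_edgeFinset {V : Type*} [Fintype V] [Nonempty V] (H : SimpleGraph V) {k : ℕ}
    (hk : H.edgeFinset.card = k) {μ : ℝ} (hμ : spectralRadius Hᶜ + 1 = μ) (hμ1 : 1 < μ) :
    (k : ℝ) * (2 * μ - k - 1) ≤ (Fintype.card V - μ) * (μ ^ 2 - k) := by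
  obtain ⟨x, hx, ⟨v₀, hv₀⟩, he⟩ := exists_nonneg_eigenvector Hᶜ
  set X := ∑ v, x v with hX
  have hXpos : 0 < X := Finset.sum_pos' (fun v _ => hx v)
    ⟨v₀, Finset.mem_univ _, lt_of_le_of_ne (hx v₀) (Ne.symm hv₀)⟩
  have hd : ∀ v, ∑ u, (if H.Adj v u then (1 : ℝ) else 0) = H.degree v := fun v => by
    rw [Finset.sum_boole, ← H.card_neighborFinset_eq_degree]
    congr 2
    ext u
    simp
  have hxv : ∀ v, μ * x v = X - ∑ u, (if H.Adj v u then x u else 0) := by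
    intro v
    have h1 : X = ∑ u, (if Hᶜ.Adj v u then x u else 0) + ∑ u, (if H.Adj v u then x u else 0)
        + ∑ u, (if v = u then x u else 0) := by
      rw [← Finset.sum_add_distrib, ← Finset.sum_add_distrib]
      refine Finset.sum_congr rfl fun u _ => ?_
      by_cases h2 : v = u
      · subst h2; simp
      · by_cases h3 : H.Adj v u <;> simp [h2, h3]
    have hev := he v
    rw [Finset.sum_ite_eq, if_pos (Finset.mem_univ v)] at h1
    have hμv : μ * x v = spectralRadius Hᶜ * x v + x v := by rw [← hμ]; ring
    have : ∑ u, (if Hᶜ.Adj v u then x u else 0) = spectralRadius Hᶜ * x v := by convert hev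
    linarith
  have hsumd : ∑ v, (H.degree v : ℝ) = 2 * k := by
    rw [← hk]
    exact_mod_cast H.sum_degrees_eq_twice_card_edges
  set Q := ∑ v, (H.degree v : ℝ) * x v with hQ
  have hQ1 : Q = ∑ v, ∑ u, if H.Adj v u then x v else 0 := by
    refine Finset.sum_congr rfl fun v _ => ?_
    rw [← hd, Finset.sum_mul]
    simp
  have hQ2 : Q = ∑ v, ∑ u, if H.Adj v u then x u else 0 := by
    rw [hQ1, Finset.sum_comm]
    simp only [H.adj_comm]
  have hQX : μ * X = Fintype.card V * X - Q := by
    rw [hQ2, hX, Finset.mul_sum]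
    simp only [hxv, Finset.sum_sub_distrib]
    simp [hX]
  set R := ∑ v, ∑ u, (if H.Adj v u then (H.degree v : ℝ) * x u else 0) with hR
  have hR2 : R = ∑ v, ∑ u, (if H.Adj v u then (H.degree u : ℝ) * x v else 0) := by
    rw [hR, Finset.sum_comm]
    simp only [H.adj_comm]
  have hQR : μ * Q = 2 * k * X - R := by
    rw [← hsumd, hQ, hR, Finset.mul_sum, Finset.sum_mul, ← Finset.sum_sub_distrib]
    refine Finset.sum_congr rfl fun v _ => ?_
    have := congrArg ((H.degree v : ℝ) * ·) (hxv v)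
    simp only [mul_sub, Finset.mul_sum, mul_ite, mul_zero] at this
    linarith
  -- The key edge estimate. Equality holds on a star: with `v` the leaf and `u` the centre, `d v =
  -- 1`, `d u = k`, and `u` is the only `H`-neighbour of `v`.
  have hterm : ∀ v u, H.Adj v u → (μ - 1) * (H.degree v * x u + H.degree u * x v)
      ≤ (μ - 1) * (x v + x u) + (k - 1) * (X - x v - x u) := by
    have main : ∀ v u, H.Adj v u → x u ≤ x v → (μ - 1) * (H.degree v * x u + H.degree u * x v)
      ≤ (μ - 1) * (x v + x u) + (k - 1) * (X - x v - x u) := by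
      intro v u hvu hle
      have h1 : (H.degree v : ℝ) + H.degree u ≤ k + 1 := by
        rw [← hk]
        exact_mod_cast degree_add_degree_le H hvu.ne
      have h2 : (1 : ℝ) ≤ H.degree v := by
        exact_mod_cast (H.degree_pos_iff_exists_adj v).2 ⟨u, hvu⟩
      have h3 : (1 : ℝ) ≤ H.degree u := by
        exact_mod_cast (H.degree_pos_iff_exists_adj u).2 ⟨v, hvu.symm⟩
      have h4 : x u ≤ ∑ w, (if H.Adj v w then x w else 0) := by
        have := Finset.single_le_sum (f := fun w => if H.Adj v w then x w else 0)
          (fun w _ => by split_ifs; exacts [hx w, le_rfl]) (Finset.mem_univ u)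
        simpa [hvu] using this
      have h5 : (μ - 1) * x v ≤ X - x v - x u := by
        have := hxv v
        linarith
      have h6 : (H.degree v : ℝ) * x u + H.degree u * x v ≤ (x v + x u) + (k - 1) * x v := by
        nlinarith [mul_nonneg (sub_nonneg.2 h1) (hx u),
          mul_nonneg (by linarith : (0 : ℝ) ≤ k - H.degree u) (sub_nonneg.2 hle)]
      have h7 := mul_le_mul_of_nonneg_left h6 (by linarith : (0 : ℝ) ≤ μ - 1)
      have h8 := mul_le_mul_of_nonneg_left h5 (by linarith : (0 : ℝ) ≤ (k : ℝ) - 1)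
      linarith
    intro v u hvu
    rcases le_total (x u) (x v) with h | h
    · exact main v u hvu h
    · have := main u v hvu.symm h
      linarith
  have hsum : (μ - 1) * (R + R) ≤ (μ - 1) * (Q + Q) + (k - 1) * (2 * k * X - Q - Q) := by
    have e1 : (μ - 1) * (R + R) = ∑ v, ∑ u, if H.Adj v u then
        (μ - 1) * (H.degree v * x u + H.degree u * x v) else 0 := by
      nth_rewrite 1 [hR]
      rw [hR2]
      simp only [← Finset.sum_add_distrib, Finset.mul_sum]
      refine Finset.sum_congr rfl fun v _ => Finset.sum_congr rfl fun u _ => ?_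
      split_ifs <;> simp
    have e2 : 2 * k * X = ∑ v, ∑ u, if H.Adj v u then X else 0 := by
      rw [← hsumd, Finset.sum_mul]
      refine Finset.sum_congr rfl fun v _ => ?_
      rw [← hd, Finset.sum_mul]
      simp
    have e3 : (μ - 1) * (Q + Q) + (k - 1) * (2 * k * X - Q - Q) = ∑ v, ∑ u, if H.Adj v u then
        (μ - 1) * (x v + x u) + (k - 1) * (X - x v - x u) else 0 := by
      rw [e2]
      nth_rewrite 1 [hQ1]
      nth_rewrite 1 [hQ2]
      nth_rewrite 1 [hQ1]
      nth_rewrite 1 [hQ2]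
      simp only [← Finset.sum_add_distrib, ← Finset.sum_sub_distrib, Finset.mul_sum]
      refine Finset.sum_congr rfl fun v _ => Finset.sum_congr rfl fun u _ => ?_
      split_ifs <;> simp
    rw [e1, e3]
    refine Finset.sum_le_sum fun v _ => Finset.sum_le_sum fun u _ => ?_
    split_ifs with h
    · exact hterm v u h
    · exact le_rfl
  have hfin : (k * (2 * μ - k - 1)) * X ≤ ((Fintype.card V - μ) * (μ ^ 2 - k)) * X := by
    have e1 : Q = (Fintype.card V - μ) * X := by linarith
    have e2 : R = 2 * k * X - μ * Q := by linarith
    rw [e2] at hsum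
    calc _ ≤ Q * (μ ^ 2 - k) := by linarith
      _ = _ := by rw [e1]; ring
  exact le_of_mul_le_mul_right hfin hXpos

open Classical in
/-- Weights that are constant on the three vertex classes of the extremal graph form a subsolution
of the eigenvector equation as soon as they do so on each class. -/
theorem le_spectralRadius_extremalGraph_of_le {a k : ℕ} (ha : 1 ≤ a) {r q p : ℝ}
    (hq : 0 ≤ q) (hp : 0 ≤ p) (h1 : r + 1 ≤ a + k * q + p) (h2 : r * q + q ≤ a + k * q)
    (h3 : r * p ≤ a) : r ≤ spectralRadius (extremalGraph a (a + 1 + k)) := by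
  have hc : ((a + 1 + k - a - 1 : ℕ) : ℝ) = k := by congr 1; omega
  refine le_spectralRadius_of_le (extremalGraph a (a + 1 + k))
    (Sum.elim (fun _ => 1) (Sum.elim (fun _ => q) fun _ => p)) ?_
    (v₀ := Sum.inl ⟨0, ha⟩) (by simp) ?_
  · rintro (v | v | v) <;> simp [hq, hp]
  · have hcl : ∀ (m : ℕ) (v : Fin m) (c : ℝ),
        ∑ u, (if v = u then 0 else c) = m * c - c := by
      intro m v c
      have : ∀ u, (if v = u then 0 else c) = c - if v = u then c else 0 := fun u => by
        split_ifs <;> simp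
      simp only [this, Finset.sum_sub_distrib, Finset.sum_ite_eq]
      simp
    rintro (v | v | v) <;> rw [Fintype.sum_sum_type, Fintype.sum_sum_type]
    · simp [extremalGraph, join, hcl, hc, -Finset.sum_boole]
      linarith
    · simp [extremalGraph, join, hcl, hc, -Finset.sum_boole]
      linarith
    · simp [extremalGraph, join, -Finset.sum_boole, Subsingleton.elim v 0]
      linarith

/-- Comes from the clique on `a + k` vertices; it ensures that a counterexample has `μ > a + k`, the
range where the cubic inequality can be used. -/
theorem clique_le_spectralRadius_extremalGraph {a k : ℕ} (ha : 1 ≤ a) :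
    (a : ℝ) + k - 1 ≤ spectralRadius (extremalGraph a (a + 1 + k)) :=
  le_spectralRadius_extremalGraph_of_le ha zero_le_one le_rfl (by linarith) (by linarith)
    (by simp)

/-- The extremal graph has spectral radius at least `μ - 1` wherever the cubic allows it. -/
theorem le_spectralRadius_extremalGraph {a k : ℕ} (ha : 1 ≤ a) {μ : ℝ} (hμ : (a : ℝ) + k < μ)
    (hcub : (k : ℝ) * (2 * μ - k - 1) ≤ (a + 1 + k - μ) * (μ ^ 2 - k)) :
    μ - 1 ≤ spectralRadius (extremalGraph a (a + 1 + k)) := by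
  have ha' : (1 : ℝ) ≤ a := by exact_mod_cast ha
  have hk0 : (0 : ℝ) ≤ k := Nat.cast_nonneg k
  have hkμ : (k : ℝ) < μ := by linarith
  have hμ1 : 1 < μ := by linarith
  have hden : 0 < μ ^ 2 - k := by nlinarith
  -- This `r` makes the three subsolution conditions for the weights `1`, `1 - r`, `μ * r` coincide
  -- with `hS`, which after clearing denominators is `(μ - a - k)(μ² - k) ≤ (μ - k)²`, a
  -- rearrangement of `hcub`.
  obtain ⟨r, hr⟩ : ∃ r, r = (μ - k) / (μ ^ 2 - k) := ⟨_, rfl⟩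
  have hr' : r * (μ ^ 2 - k) = μ - k := by rw [hr, div_mul_cancel₀ _ hden.ne']
  have hr0 : 0 ≤ r := by rw [hr]; exact div_nonneg (by linarith) hden.le
  have hr1 : r ≤ 1 := by
    rw [hr, div_le_one hden]
    nlinarith
  have hS : μ ≤ a + k * (1 - r) + μ * r := by
    have : (μ - a - k) * (μ ^ 2 - k) ≤ ((μ - k) * r) * (μ ^ 2 - k) := by
      rw [mul_assoc, hr']
      linarith
    have := le_of_mul_le_mul_right this hden
    linarith
  refine le_spectralRadius_extremalGraph_of_le ha (q := 1 - r) (p := μ * r) (by linarith)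
    (mul_nonneg (by linarith) hr0) (by linarith) (by linarith) ?_
  linarith

open Classical in
/-- Among the graphs of order `n` missing at least `n - a - 1` edges, the extremal graph has the
largest spectral radius. -/
theorem spectralRadius_le_extremalGraph {V : Type*} [Fintype V] (G : SimpleGraph V) {a n : ℕ}
    (ha : 1 ≤ a) (han : a + 2 ≤ n) (hn : Fintype.card V = n)
    (hG : n ≤ Gᶜ.edgeFinset.card + a + 1) :
    spectralRadius G ≤ spectralRadius (extremalGraph a n) := by
  obtain ⟨k, rfl⟩ : ∃ k, n = a + 1 + k := ⟨n - (a + 1), by omega⟩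
  -- Restoring all but `k` missing edges only increases the spectral radius.
  obtain ⟨F, hF, hFc⟩ := Finset.exists_subset_card_eq (show k ≤ Gᶜ.edgeFinset.card by omega)
  have : Nonempty V := Fintype.card_pos_iff.1 (by omega)
  have hle : SimpleGraph.fromEdgeSet (F : Set (Sym2 V)) ≤ Gᶜ := by
    rw [← Gᶜ.fromEdgeSet_edgeSet]
    apply SimpleGraph.fromEdgeSet_mono
    rw [← SimpleGraph.coe_edgeFinset]
    exact_mod_cast hF
  have hcard : (SimpleGraph.fromEdgeSet (F : Set (Sym2 V))).edgeFinset.card = k := by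
    rw [← hFc]
    congr 1
    rw [← Finset.coe_inj, SimpleGraph.coe_edgeFinset, SimpleGraph.edgeSet_fromEdgeSet]
    refine sdiff_eq_left.2 (Set.disjoint_left.2 fun e he hd => ?_)
    have : e ∈ Gᶜ.edgeSet := SimpleGraph.mem_edgeFinset.1 (hF he)
    exact Gᶜ.not_isDiag_of_mem_edgeSet this hd
  have hG' : G ≤ (SimpleGraph.fromEdgeSet (F : Set (Sym2 V)))ᶜ := le_compl_comm.1 hle
  refine (spectralRadius_mono hG').trans ?_
  by_contra! hlt
  have h1 := clique_le_spectralRadius_extremalGraph (k := k) ha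
  have h2 : (1 : ℝ) ≤ a := by exact_mod_cast ha
  have h3 : (0 : ℝ) ≤ k := Nat.cast_nonneg k
  have hc := cubic_of_card_edgeFinset _ (k := k) (by convert hcard) rfl (by linarith)
  rw [hn] at hc
  push_cast at hc
  have := le_spectralRadius_extremalGraph ha (by linarith) hc
  linarith

/-! ### Sharpness and conclusion -/

-- The `K_1` vertex has degree `a`; after deleting one of its edges the remaining weights, each at
-- most 1, sum to at most `a - 1`.
open Classical in
theorem not_isFractionalDeleted_extremalGraph {a b n : ℕ} (ha : 1 ≤ a) :
    ¬ IsFractionalDeleted (extremalGraph a n) a b := by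
  intro h
  obtain ⟨f, hf, hdeg⟩ := h s(Sum.inr (Sum.inr 0), Sum.inl ⟨0, ha⟩)
    (by simp [extremalGraph, join])
  have h1 := (hdeg (Sum.inr (Sum.inr 0))).1
  rw [sum_incidenceFinset] at h1
  have h2 : ∀ i : Fin a, (if ((extremalGraph a n).deleteEdges
      {s(Sum.inr (Sum.inr 0), Sum.inl ⟨0, ha⟩)}).Adj (Sum.inr (Sum.inr 0)) (Sum.inl i)
      then f s(Sum.inr (Sum.inr 0), Sum.inl i) else 0) ≤ if i = ⟨0, ha⟩ then 0 else 1 := by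
    intro i
    split_ifs with h3 h4 h4
    · subst h4
      simp at h3
    · exact (hf _ h3).2
    · exact le_rfl
    · exact zero_le_one
  rw [Fintype.sum_sum_type, Fintype.sum_sum_type] at h1
  have h3 := Finset.sum_le_sum fun i (_ : i ∈ Finset.univ) => h2 i
  simp [Finset.sum_ite, Finset.filter_ne'] at h3
  simp [extremalGraph, join] at h1 h3
  simp only [Finset.sum_ite, Finset.sum_const_zero, zero_add] at h1
  have h4 : (a : ℝ) ≤ (a - 1 : ℕ) := h1.trans h3
  norm_cast at h4
  omega

end FractionalDeleted

/-- The first part is the sufficient condition; the second part is its sharpness: the graph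
`K_a ∨ (K_{n-a-1} ∪ K_1)` has order `n` and is not fractional `[a,b]`-deleted, so `>` cannot be
replaced by `≥`. -/
theorem theorem1p4 :
    (∀ (a b n : ℕ), 1 ≤ a → max a 3 ≤ b → max (a + 2) 7 ≤ n →
      ∀ (V : Type*) [Fintype V] (G : SimpleGraph V), Fintype.card V = n →
        FractionalDeleted.spectralRadius G >
          FractionalDeleted.spectralRadius (FractionalDeleted.extremalGraph a n) →
        FractionalDeleted.IsFractionalDeleted G a b) ∧
    (∀ (a b n : ℕ), 1 ≤ a → a ≤ b → a + 2 ≤ n →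
      Fintype.card (Fin a ⊕ (Fin (n - a - 1) ⊕ Fin 1)) = n ∧
      ¬ FractionalDeleted.IsFractionalDeleted (FractionalDeleted.extremalGraph a n) a b) := by
  classical
  refine ⟨fun a b n ha hb hn V _ G hV hρ e he => ?_, fun a b n ha hab hn => ⟨?_, ?_⟩⟩
  · by_contra hno
    have hab : a ≤ b := (le_max_left _ _).trans hb
    have hb3 : 3 ≤ b := (le_max_right _ _).trans hb
    have han : a + 2 ≤ n := (le_max_left _ _).trans hn
    have hcard := FractionalDeleted.card_edgeFinset_compl_of_no_factor (G.deleteEdges {e}) hab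
      (by omega) hV han hno
    -- Deleting `e` adds at most one missing edge, which turns the bound `n - a` into `n - a - 1`.
    have hins : (G.deleteEdges {e})ᶜ.edgeFinset ⊆ insert e Gᶜ.edgeFinset := by
      intro e'
      induction e' with
      | _ v u =>
        simp only [SimpleGraph.mem_edgeFinset, SimpleGraph.mem_edgeSet, SimpleGraph.compl_adj,
          SimpleGraph.deleteEdges_adj, Finset.mem_insert, Set.mem_singleton_iff]
        tauto
    have h1 := (Finset.card_le_card hins).trans (Finset.card_insert_le _ _)
    refine absurd hρ (not_lt.2 (FractionalDeleted.spectralRadius_le_extremalGraph G ha han hV ?_))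
    have h2 : n ≤ (G.deleteEdges {e})ᶜ.edgeFinset.card + a := by convert hcard
    have h3 : n ≤ Gᶜ.edgeFinset.card + a + 1 := by omega
    convert h3
  · simp only [Fintype.card_sum, Fintype.card_fin]
    omega
  · exact FractionalDeleted.not_isFractionalDeleted_extremalGraph ha
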